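/- Let an occurrence of the pattern $1\text{-}2\text{-}3$ in a permutation $\pi=\pi_1\pi_2\cdots\pi_n$ of $\{1,\dots,n\}$ be a triple of positions $i<j<k$ with $\pi_i<\pi_j<\pi_k$. An occurrence of $1\text{-}23$ is such a triple with $k=j+1$, and an occurrence of $12\text{-}3$ is such a triple with $j=i+1$. Let $f_n$ be the number of permutations of length $n$ with exactly one occurrence of $1\text{-}2\text{-}3$, no occurrence of $1\text{-}23$ and no occurrence of $12\text{-}3$. Let $C(x)=\sum_{n\ge 0}\frac{1}{n+1}\binom{2n}{n}x^n=\frac{1-\sqrt{1-4x}}{2x}$ be the Catalan generating function. Then $f_n=0$ for $n<5$, and $$\sum_{n\ge 5} f_n x^n \;=\; x^5C(x)^8 \;=\; \sum_{n\ge 5}\frac{8}{n+3}\binom{2n-3}{n+2}x^n$$ as formal power series; that is, $f_n=\frac{8}{n+3}\binom{2n-3}{n+2}$ for all $n\ge 5$. -/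

import Mathlib

/-- The occurrences of the pattern 1-2-3 in a permutation `π` of length `n`, as triples of positions
`i < j < k` with `π i < π j < π k`; no adjacency of positions is required. -/
def occurrences1d2d3 {n : ℕ} (π : Equiv.Perm (Fin n)) : Finset (Fin n × Fin n × Fin n) :=
  Finset.univ.filter fun t =>
    t.1 < t.2.1 ∧ t.2.1 < t.2.2 ∧ π t.1 < π t.2.1 ∧ π t.2.1 < π t.2.2

/-- The occurrences of the pattern 1-23: those of 1-2-3 in which the last two of the three
positions are adjacent. -/
def occurrences1d23 {n : ℕ} (π : Equiv.Perm (Fin n)) : Finset (Fin n × Fin n × Fin n) :=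
  (occurrences1d2d3 π).filter fun t => (t.2.2 : ℕ) = (t.2.1 : ℕ) + 1

/-- The occurrences of the pattern 12-3: those of 1-2-3 in which the first two of the three
positions are adjacent. -/
def occurrences12d3 {n : ℕ} (π : Equiv.Perm (Fin n)) : Finset (Fin n × Fin n × Fin n) :=
  (occurrences1d2d3 π).filter fun t => (t.2.1 : ℕ) = (t.1 : ℕ) + 1

/-- `countPerms n` is the number of permutations of length `n` with exactly one occurrence of 1-2-3 and no
occurrence of 1-23 or of 12-3. -/
def countPerms (n : ℕ) : ℕ :=
  (Finset.univ.filter fun π : Equiv.Perm (Fin n) =>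
    (occurrences1d2d3 π).card = 1 ∧ (occurrences1d23 π).card = 0 ∧
      (occurrences12d3 π).card = 0).card

/-! ### Lehmer codes as lists -/

/-! Build a permutation from right to left: prepend a value v and shift up the old values that are
at least v. The values v form the Lehmer code. The new occurrences of 1-2-3 correspond to the
ascending pairs with old values at least v (`codeAsc`), so occurrences never disappear. If exactly k
values create none (`HasLabel`), they are the k largest, and prepending them leads to labels 2, ...,
k + 1. This is the Catalan generating tree, where the nodes below label k are counted by C^k
(`catalanInt_pow`). Once the one permitted occurrence is present, only such harmless values remain,
which gives C^k (`goodExt_of_isGood`).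

Before that, the value creating the occurrence needs exactly one ascending pair above it, neither
adjacent nor at the front. The state (k, m, s, p) of `IsAvoider` suffices to track this. Such a pair
arises when the second largest value is prepended to a permutation not starting with its maximum. It
becomes usable after a new maximum is put in front, and any other harmless step destroys the
opportunity. The resulting recursion on states is solved by `avoiderSeries`, whose value at the
empty code is X^5 C^8. -/

/-- A list is a Lehmer code if each entry is at most the number of entries after it. -/
def IsLehmer : List ℕ → Prop
  | [] => True
  | v :: l => v ≤ l.length ∧ IsLehmer l

/-- The number of pairs of positions `i < j` with values `w ≤ π i < π j`, in terms of the Lehmer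
code of `π`. -/
def codeAsc : List ℕ → ℕ → ℕ
  | [], _ => 0
  | v :: l, w => if w ≤ v then (l.length - v) + codeAsc l w else codeAsc l (w - 1)

/-- The number of those pairs counted by `codeAsc` in which the positions are adjacent. -/
def codeAdj : List ℕ → ℕ → ℕ
  | [], _ => 0
  | v :: l, w =>
    if w ≤ v then (if ∃ u ∈ l.head?, v ≤ u then 1 else 0) + codeAdj l w else codeAdj l (w - 1)

/-- The number of those pairs counted by `codeAsc` in which the first position is the initial
one. -/
def codeInit : List ℕ → ℕ → ℕ
  | [], _ => 0
  | v :: l, w => if w ≤ v then l.length - v else 0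

/-- The number of occurrences of 1-2-3, in terms of the Lehmer code. -/
def codeOcc : List ℕ → ℕ
  | [] => 0
  | v :: l => codeAsc l v + codeOcc l

/-- The number of occurrences of 1-23, in terms of the Lehmer code. -/
def codeOcc1d23 : List ℕ → ℕ
  | [] => 0
  | v :: l => codeAdj l v + codeOcc1d23 l

/-- The number of occurrences of 12-3, in terms of the Lehmer code. -/
def codeOcc12d3 : List ℕ → ℕ
  | [] => 0
  | v :: l => codeInit l v + codeOcc12d3 l

/-- Exactly one occurrence of 1-2-3, and none of 1-23 or 12-3. -/
abbrev IsGood (l : List ℕ) : Prop := codeOcc l = 1 ∧ codeOcc1d23 l = 0 ∧ codeOcc12d3 l = 0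

/-- The number of good codes obtained from `l` by prepending `r` entries. -/
def goodExt : ℕ → List ℕ → ℕ
  | 0, l => if IsGood l then 1 else 0
  | r + 1, l => ∑ v ∈ Finset.range (l.length + 1), goodExt r (v :: l)

/-- The number of values that can be prepended without creating an occurrence of 1-2-3 is `k`. -/
def HasLabel (l : List ℕ) (k : ℕ) : Prop :=
  1 ≤ k ∧ k ≤ l.length + 1 ∧ ∀ w, codeAsc l w = 0 ↔ l.length + 1 ≤ w + k

/-! ### Effect of prepending on counts and labels -/

theorem IsLehmer.head_lt {l : List ℕ} (h : IsLehmer l) : ∀ u ∈ l.head?, u < l.length := by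
  cases l with
  | nil => simp
  | cons v l => simpa [Nat.lt_succ_iff] using h.1

theorem codeInit_le_codeAsc (l : List ℕ) (w : ℕ) : codeInit l w ≤ codeAsc l w := by
  cases l with
  | nil => simp [codeInit]
  | cons v l => simp only [codeInit, codeAsc]; split_ifs <;> omega

theorem IsLehmer.codeAdj_le_codeAsc {l : List ℕ} (h : IsLehmer l) (w : ℕ) :
    codeAdj l w ≤ codeAsc l w := by
  induction l generalizing w with
  | nil => simp [codeAdj]
  | cons v l ih =>
    have h1 := ih h.2 w
    have h2 := ih h.2 (w - 1)
    have h3 := h.2.head_lt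
    simp only [codeAdj, codeAsc]
    split_ifs with hw hu
    · obtain ⟨u, hu, hvu⟩ := hu
      have := h3 u hu
      omega
    · omega
    · omega

theorem HasLabel.cons_length {l : List ℕ} {k : ℕ} (h : HasLabel l k) :
    HasLabel (l.length :: l) (k + 1) := by
  obtain ⟨h1, h2, h3⟩ := h
  refine ⟨by omega, by simp only [List.length_cons]; omega, fun w => ?_⟩
  simp only [codeAsc, List.length_cons]
  have a := h3 w
  have b := h3 (w - 1)
  split_ifs <;> omega

theorem HasLabel.cons_sub {l : List ℕ} {k i : ℕ} (h : HasLabel l k) (hi : 1 ≤ i) (hik : i < k) :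
    HasLabel ((l.length - i) :: l) (i + 1) := by
  obtain ⟨h1, h2, h3⟩ := h
  refine ⟨by omega, by simp only [List.length_cons]; omega, fun w => ?_⟩
  simp only [codeAsc, List.length_cons]
  have a := h3 w
  have b := h3 (w - 1)
  split_ifs <;> omega

/-- This is the step that creates the occurrence: a value below all harmless ones leaves their
number unchanged. -/
theorem HasLabel.cons_of_lt {l : List ℕ} {k v : ℕ} (h : HasLabel l k)
    (hv : v + k < l.length + 1) : HasLabel (v :: l) k := by
  obtain ⟨h1, h2, h3⟩ := h
  refine ⟨by omega, by simp only [List.length_cons]; omega, fun w => ?_⟩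
  simp only [codeAsc, List.length_cons]
  have a := h3 w
  have b := h3 (w - 1)
  split_ifs <;> omega

theorem goodExt_eq_zero (r : ℕ) {l : List ℕ}
    (h : 2 ≤ codeOcc l ∨ 0 < codeOcc1d23 l ∨ 0 < codeOcc12d3 l) : goodExt r l = 0 := by
  induction r generalizing l with
  | zero => rw [goodExt, if_neg]; rintro ⟨h1, h2, h3⟩; omega
  | succ r ih =>
    rw [goodExt]
    refine Finset.sum_eq_zero fun v _ => ih ?_
    simp only [codeOcc, codeOcc1d23, codeOcc12d3]
    omega

/-- Separates the values that create occurrences from the `k` harmless ones, indexed by their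
distance from the maximum. -/
theorem sum_range_succ_split {M : Type*} [AddCommMonoid M] (f : ℕ → M) {n k : ℕ}
    (hk : k ≤ n + 1) :
    ∑ v ∈ Finset.range (n + 1), f v =
      ∑ v ∈ Finset.range (n + 1 - k), f v + ∑ i ∈ Finset.range k, f (n - i) := by
  rw [← Finset.sum_range_add_sum_Ico f (Nat.sub_le (n + 1) k), Finset.sum_Ico_eq_sum_range]
  congr 1
  rw [Nat.sub_sub_self hk, ← Finset.sum_range_reflect]
  refine Finset.sum_congr rfl fun i hi => ?_
  rw [Finset.mem_range] at hi
  congr 1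
  omega

/-! ### The generating functions -/

open PowerSeries in
/-- The Catalan generating function with integer coefficients. -/
noncomputable def catalanInt : PowerSeries ℤ := PowerSeries.map (Nat.castRingHom ℤ) catalanSeries

open PowerSeries in
theorem catalanInt_eq : catalanInt = 1 + X * catalanInt ^ 2 := by
  have h := congrArg (PowerSeries.map (Nat.castRingHom ℤ)) catalanSeries_sq_mul_X_add_one
  simp only [map_add, map_mul, map_pow, map_one, PowerSeries.map_X] at h
  rw [catalanInt]
  linear_combination -h

-- The rule of the Catalan tree: stop, or pass from label `k + 1` to `k + 2` or to some `i + 2` with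
-- `i < k`.
open PowerSeries in
theorem catalanInt_pow (k : ℕ) :
    catalanInt ^ (k + 1) =
      1 + X * (catalanInt ^ (k + 2) + ∑ i ∈ Finset.range k, catalanInt ^ (i + 2)) := by
  induction k with
  | zero => simpa using catalanInt_eq
  | succ k ih =>
    rw [Finset.sum_range_succ]
    linear_combination ih + catalanInt ^ (k + 1) * catalanInt_eq

open PowerSeries in
theorem goodExt_of_isGood (r : ℕ) {l : List ℕ} {k : ℕ} (hl : IsLehmer l) (hk : HasLabel l k)
    (hg : IsGood l) : (goodExt r l : ℤ) = coeff r (catalanInt ^ k) := by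
  induction r generalizing l k with
  | zero =>
    have : constantCoeff catalanInt = 1 := by rw [catalanInt_eq]; simp
    simp [goodExt, hg, this]
  | succ r ih =>
    obtain ⟨k, rfl⟩ : ∃ j, k = j + 1 := ⟨k - 1, by have := hk.1; omega⟩
    obtain ⟨hg1, hg2, hg3⟩ := hg
    have good : ∀ v, l.length + 1 ≤ v + (k + 1) → IsGood (v :: l) := fun v hv => by
      have h1 := (hk.2.2 v).2 hv
      have h2 := codeInit_le_codeAsc l v
      have h3 := hl.codeAdj_le_codeAsc v
      simp only [IsGood, codeOcc, codeOcc1d23, codeOcc12d3]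
      omega
    -- A value outside the label creates a second occurrence.
    have h0 : ∑ v ∈ Finset.range (l.length + 1 - (k + 1)), goodExt r (v :: l) = 0 := by
      refine Finset.sum_eq_zero fun v hv => goodExt_eq_zero r ?_
      rw [Finset.mem_range] at hv
      have := hk.2.2 v
      simp only [codeOcc]
      omega
    rw [goodExt, sum_range_succ_split _ hk.2.1, h0, zero_add, Finset.sum_range_succ', add_comm,
      catalanInt_pow]
    push_cast
    rw [map_add, coeff_one, if_neg (Nat.succ_ne_zero r), zero_add, coeff_succ_X_mul, map_add,
      map_sum]
    congr 1
    · exact ih ⟨by simp, hl⟩ hk.cons_length (good _ (by simp))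
    · refine Finset.sum_congr rfl fun i hi => ?_
      rw [Finset.mem_range] at hi
      have := hk.2.1
      exact ih ⟨by omega, hl⟩ (hk.cons_sub (by omega) (by omega)) (good _ (by omega))

/-! ### States of 1-2-3-avoiding codes -/

/-- The values whose insertion in front creates exactly one occurrence of 1-2-3 and no occurrence
of 1-23. -/
def admissibleValues (l : List ℕ) : Finset ℕ :=
  (Finset.range (l.length + 1)).filter fun v => codeAsc l v = 1 ∧ codeAdj l v = 0

/-- `l` is the code of a permutation without occurrences of 1-2-3 with label `k`; `m` tells whether
it starts with its maximum, `s` is the number of admissible values, and `p` tells whether inserting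
one of these creates an occurrence of 12-3. -/
structure IsAvoider (l : List ℕ) (k : ℕ) (m : Bool) (s : ℕ) (p : Bool) : Prop where
  isLehmer : IsLehmer l
  label : HasLabel l k
  occ : codeOcc l = 0
  occ1d23 : codeOcc1d23 l = 0
  occ12d3 : codeOcc12d3 l = 0
  startsMax : m = true ↔ ∃ u ∈ l.head?, l.length - 1 ≤ u
  card_admissible : (admissibleValues l).card = s
  init_admissible : ∀ v ∈ admissibleValues l, codeInit l v = 0 ↔ p = false

theorem IsAvoider.occ_cons {l : List ℕ} {k s : ℕ} {m p : Bool} (h : IsAvoider l k m s p) {v : ℕ}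
    (hv : l.length + 1 ≤ v + k) :
    codeOcc (v :: l) = 0 ∧ codeOcc1d23 (v :: l) = 0 ∧ codeOcc12d3 (v :: l) = 0 := by
  have h1 := (h.label.2.2 v).2 hv
  have h2 := codeInit_le_codeAsc l v
  have h3 := h.isLehmer.codeAdj_le_codeAsc v
  have h4 := h.occ
  have h5 := h.occ1d23
  have h6 := h.occ12d3
  simp only [codeOcc, codeOcc1d23, codeOcc12d3]
  omega

theorem isAvoider_nil : IsAvoider [] 1 false 0 false where
  isLehmer := trivial
  label := ⟨le_rfl, le_rfl, fun w => by simp [codeAsc]⟩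
  occ := rfl
  occ1d23 := rfl
  occ12d3 := rfl
  startsMax := by simp
  card_admissible := by simp [admissibleValues, codeAsc]
  init_admissible := by simp [admissibleValues, codeAsc]

/-- A leading maximum starts no ascending pair. The old pairs remain, but none of them is at the
front any more, so `p` is switched off. -/
theorem IsAvoider.cons_length {l : List ℕ} {k s : ℕ} {m p : Bool} (h : IsAvoider l k m s p) :
    IsAvoider (l.length :: l) (k + 1) true s false := by
  have hocc := h.occ_cons (v := l.length) (by have := h.label.1; omega)
  have hK : admissibleValues (l.length :: l) = admissibleValues l := by
    ext v
    have hu : ¬ ∃ u ∈ l.head?, l.length ≤ u := fun ⟨u, hu, hlu⟩ =>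
      absurd (h.isLehmer.head_lt u hu) (by omega)
    simp only [admissibleValues, Finset.mem_filter, Finset.mem_range, codeAsc, codeAdj, if_neg hu,
      List.length_cons]
    have h1 := h.label.1
    have h2 := h.label.2.2 (v - 1)
    split_ifs <;> omega
  refine ⟨⟨le_rfl, h.isLehmer⟩, h.label.cons_length, hocc.1, hocc.2.1, hocc.2.2, ?_, ?_, ?_⟩
  · simp
  · rw [hK, h.card_admissible]
  · intro v _
    simp [codeInit]

/-- The new entry starts exactly `i` ascending pairs, so a single new occurrence forces `i = 1`, the
pair being this entry and the maximum. The pair is non-adjacent exactly when `l` does not start with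
its maximum. The admissible values are then the `k - 1` values harmless for `l` that do not exceed
the new entry. The pair is at the front, hence `p = true`. -/
theorem IsAvoider.cons_sub {l : List ℕ} {k s i : ℕ} {m p : Bool} (h : IsAvoider l k m s p)
    (hi : 1 ≤ i) (hik : i < k) :
    IsAvoider ((l.length - i) :: l) (i + 1) false (if i = 1 ∧ m = false then k - 1 else 0) true := by
  have hocc := h.occ_cons (v := l.length - i) (by have := h.label.2.1; omega)
  have h2 := h.label.2.1
  have hK : admissibleValues ((l.length - i) :: l) =
      if i = 1 ∧ m = false then Finset.Ico (l.length + 1 - k) l.length else ∅ := by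
    ext v
    have h3 := h.label.2.2 (v - 1)
    have h4 := h.label.2.2 v
    have h5 := h.isLehmer.codeAdj_le_codeAsc v
    rw [admissibleValues, Finset.mem_filter, Finset.mem_range]
    simp only [codeAsc, codeAdj, List.length_cons]
    by_cases hi1 : i = 1
    · subst hi1
      simp only [← h.startsMax]
      cases m <;> simp
      · split_ifs <;> omega
      · split_ifs <;> omega
    · simp only [hi1, false_and, if_false, Finset.notMem_empty, iff_false]
      split_ifs <;> omega
  refine ⟨⟨Nat.sub_le _ _, h.isLehmer⟩, h.label.cons_sub hi hik, hocc.1, hocc.2.1, hocc.2.2, ?_,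
    ?_, ?_⟩
  · simp
    omega
  · rw [hK]
    split_ifs
    · rw [Nat.card_Ico]
      omega
    · rfl
  · intro v hv
    rw [hK] at hv
    split_ifs at hv with hc
    · rw [Finset.mem_Ico] at hv
      simp [codeInit]
      omega
    · simp at hv

/-! ### Solving the recursion on states -/

open PowerSeries in
/-- The generating function of the good extensions of a code satisfying `IsAvoider`. -/
noncomputable def avoiderSeries (k : ℕ) (m : Bool) (s : ℕ) (p : Bool) : PowerSeries ℤ :=
  X ^ 2 * catalanInt ^ 4 *
      ((1 - 2 * X) * catalanInt ^ k + X - 1 - if m then ((k : PowerSeries ℤ) - 1) * X else 0) +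
    (s : PowerSeries ℤ) *
      if p then X ^ 2 * catalanInt ^ (k + 2) else X * catalanInt ^ (k + 1)

-- The three summands are: inserting an admissible value, prepending the maximum, and prepending
-- another harmless value. The part linear in `s` sums over the number of maxima prepended before an
-- admissible value is used; at least one is needed if `p` holds.
open PowerSeries in
theorem avoiderSeries_rec (k : ℕ) (m : Bool) (s : ℕ) (p : Bool) :
    avoiderSeries (k + 1) m s p =
      X * ((if p then 0 else (s : PowerSeries ℤ) * catalanInt ^ (k + 1)) +
        (avoiderSeries (k + 2) true s false +
          ∑ i ∈ Finset.range k,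
            avoiderSeries (i + 2) false (if i + 1 = 1 ∧ m = false then k else 0) true)) := by
  -- Only `i = 0` can carry admissible values; with label 2 and `p = true` they contribute `k * X ^
  -- 2 * C ^ 4`.
  have hsum : ∑ i ∈ Finset.range k,
        avoiderSeries (i + 2) false (if i + 1 = 1 ∧ m = false then k else 0) true =
      X ^ 2 * catalanInt ^ 4 * ((1 - 2 * X) * ∑ i ∈ Finset.range k, catalanInt ^ (i + 2) +
        (k : PowerSeries ℤ) * (X - 1) + if m then 0 else (k : PowerSeries ℤ)) := by
    cases k with
    | zero => simp
    | succ k =>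
      rw [Finset.sum_range_succ', Finset.sum_range_succ']
      simp only [avoiderSeries]
      simp [Finset.sum_add_distrib, ← Finset.mul_sum]
      cases m <;> simp <;> ring
  have hk := catalanInt_pow k
  rw [hsum]
  simp only [avoiderSeries, if_true, Bool.false_eq_true, if_false]
  push_cast
  generalize (∑ i ∈ Finset.range k, catalanInt ^ (i + 2)) = S at hk ⊢
  have hs := congrArg (fun t => X * (s : PowerSeries ℤ) * catalanInt ^ (k + 1) * t) catalanInt_eq
  cases m <;> cases p <;> simp only [if_true, Bool.false_eq_true, if_false]
  · linear_combination X ^ 2 * catalanInt ^ 4 * (1 - 2 * X) * hk + hs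
  · linear_combination X ^ 2 * catalanInt ^ 4 * (1 - 2 * X) * hk
  · linear_combination X ^ 2 * catalanInt ^ 4 * (1 - 2 * X) * hk + hs
  · linear_combination X ^ 2 * catalanInt ^ 4 * (1 - 2 * X) * hk

theorem IsAvoider.sum_goodExt_of_lt (r : ℕ) {l : List ℕ} {k s : ℕ} {m p : Bool}
    (h : IsAvoider l k m s p) :
    ((∑ v ∈ Finset.range (l.length + 1 - k), goodExt r (v :: l) : ℕ) : ℤ) =
      PowerSeries.coeff r (if p then 0 else (s : PowerSeries ℤ) * catalanInt ^ k) := by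
  have hocc := h.occ
  have hocc1 := h.occ1d23
  have hocc2 := h.occ12d3
  have hterm : ∀ v ∈ Finset.range (l.length + 1 - k), (goodExt r (v :: l) : ℤ) =
      if v ∈ admissibleValues l then
        if p then 0 else PowerSeries.coeff r (catalanInt ^ k) else 0 := by
    intro v hv
    rw [Finset.mem_range] at hv
    have h1 := h.label.2.2 v
    have hinit := h.init_admissible v
    have hmem : v ∈ admissibleValues l ↔ codeAsc l v = 1 ∧ codeAdj l v = 0 := by
      simp only [admissibleValues, Finset.mem_filter, Finset.mem_range]
      omega
    split_ifs with hK hp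
    · rw [hmem] at hK
      rw [goodExt_eq_zero, Nat.cast_zero]
      -- When `p` holds, the ascending pair is at the front, so the insertion creates a 12-3.
      have : codeInit l v ≠ 0 := fun h0 => by simp [(hinit (hmem.2 hK)).1 h0] at hp
      simp only [codeOcc, codeOcc1d23, codeOcc12d3]
      omega
    · refine goodExt_of_isGood r ⟨by omega, h.isLehmer⟩ (h.label.cons_of_lt (by omega)) ?_
      have h0 := (hinit hK).2 (by simpa using hp)
      rw [hmem] at hK
      simp only [IsGood, codeOcc, codeOcc1d23, codeOcc12d3]
      omega
    · rw [hmem] at hK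
      rw [goodExt_eq_zero, Nat.cast_zero]
      simp only [codeOcc, codeOcc1d23, codeOcc12d3]
      omega
  -- Admissible values create an occurrence, so all of them lie below the harmless range.
  have hfilter : (Finset.range (l.length + 1 - k)).filter (· ∈ admissibleValues l) =
      admissibleValues l := by
    ext v
    have h1 := h.label.2.2 v
    simp only [admissibleValues, Finset.mem_filter, Finset.mem_range]
    omega
  rw [Nat.cast_sum, Finset.sum_congr rfl hterm, ← Finset.sum_filter, hfilter, Finset.sum_const,
    h.card_admissible]
  cases p
  · rw [if_neg Bool.false_ne_true, if_neg Bool.false_ne_true, ← nsmul_eq_mul, map_nsmul]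
  · simp

open PowerSeries in
theorem IsAvoider.goodExt_eq (r : ℕ) {l : List ℕ} {k s : ℕ} {m p : Bool}
    (h : IsAvoider l k m s p) : (goodExt r l : ℤ) = coeff r (avoiderSeries k m s p) := by
  obtain ⟨k, rfl⟩ : ∃ j, k = j + 1 := ⟨k - 1, by have := h.label.1; omega⟩
  induction r generalizing l k s m p with
  | zero =>
    have hocc := h.occ
    rw [avoiderSeries_rec, coeff_zero_X_mul, goodExt, if_neg (by simp [IsGood, hocc]), Nat.cast_zero]
  | succ r ih =>
    rw [goodExt, sum_range_succ_split _ h.label.2.1, Finset.sum_range_succ', Nat.cast_add,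
      h.sum_goodExt_of_lt r, avoiderSeries_rec, coeff_succ_X_mul, map_add, map_add, map_sum,
      Nat.cast_add, Nat.cast_sum, add_comm (∑ i ∈ Finset.range k, (_ : ℤ))]
    congr 2
    · exact ih _ h.cons_length
    · refine Finset.sum_congr rfl fun i hi => ?_
      rw [Finset.mem_range] at hi
      have := h.label.2.1
      exact ih _ (h.cons_sub (i := i + 1) (by omega) (by omega))

open PowerSeries in
theorem goodExt_nil (r : ℕ) : goodExt r [] = coeff r (X ^ 5 * catalanSeries ^ 8) := by
  have h1 := isAvoider_nil.goodExt_eq r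
  have h2 : avoiderSeries 1 false 0 false = X ^ 5 * catalanInt ^ 8 := by
    have h := catalanInt_eq
    -- By `C - 1 = X * C ^ 2`, the left side is `X * (C - 1) ^ 2`.
    have h3 : (1 - 2 * X) * catalanInt + X - 1 = X ^ 3 * catalanInt ^ 4 := by
      linear_combination (1 + X * (catalanInt - 1 + X * catalanInt ^ 2)) * h
    simp only [avoiderSeries, Bool.false_eq_true, if_false]
    push_cast
    linear_combination X ^ 2 * catalanInt ^ 4 * h3
  rw [h2, catalanInt] at h1
  have h3 : (X ^ 5 * map (Nat.castRingHom ℤ) catalanSeries ^ 8 : PowerSeries ℤ) =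
      map (Nat.castRingHom ℤ) (X ^ 5 * catalanSeries ^ 8) := by simp
  rw [h3, coeff_map] at h1
  exact Nat.cast_injective h1

/-! ### Permutations and their Lehmer codes -/

/-- Prepend the value `v` to a permutation, shifting up the values that are at least `v`. -/
noncomputable def consPerm {n : ℕ} (v : Fin (n + 1)) (π : Equiv.Perm (Fin n)) :
    Equiv.Perm (Fin (n + 1)) :=
  Equiv.ofBijective (Fin.cons v fun i => v.succAbove (π i) : Fin (n + 1) → Fin (n + 1)) <|
    Finite.injective_iff_bijective.1 <| Fin.cons_injective_iff.2
      ⟨by rintro ⟨i, hi⟩; exact Fin.succAbove_ne _ _ hi,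
        Fin.succAbove_right_injective.comp π.injective⟩

@[simp]
theorem consPerm_zero {n : ℕ} (v : Fin (n + 1)) (π : Equiv.Perm (Fin n)) :
    consPerm v π 0 = v := rfl

@[simp]
theorem consPerm_succ {n : ℕ} (v : Fin (n + 1)) (π : Equiv.Perm (Fin n)) (i : Fin n) :
    consPerm v π i.succ = v.succAbove (π i) := rfl

/-- Permutations of `Fin (n + 1)` as pairs of a first value and a permutation of `Fin n`. -/
noncomputable def consPermEquiv (n : ℕ) :
    Fin (n + 1) × Equiv.Perm (Fin n) ≃ Equiv.Perm (Fin (n + 1)) :=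
  Equiv.ofBijective (fun p => consPerm p.1 p.2) <| by
    rw [Fintype.bijective_iff_injective_and_card]
    constructor
    · rintro ⟨v, π⟩ ⟨w, σ⟩ h
      obtain rfl : v = w := by simpa using DFunLike.congr_fun h 0
      have : π = σ := Equiv.ext fun i => by simpa using DFunLike.congr_fun h i.succ
      rw [this]
    · simp [Fintype.card_perm, Nat.factorial_succ]

/-- The Lehmer code of a permutation. -/
noncomputable def lehmerCode : (n : ℕ) → Equiv.Perm (Fin n) → List ℕ
  | 0, _ => []
  | n + 1, π =>
    (((consPermEquiv n).symm π).1 : ℕ) :: lehmerCode n ((consPermEquiv n).symm π).2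

theorem lehmerCode_consPerm {n : ℕ} (v : Fin (n + 1)) (π : Equiv.Perm (Fin n)) :
    lehmerCode (n + 1) (consPerm v π) = (v : ℕ) :: lehmerCode n π := by
  have : (consPermEquiv n).symm (consPerm v π) = (v, π) :=
    (consPermEquiv n).symm_apply_apply (v, π)
  rw [lehmerCode, this]

theorem exists_consPerm {n : ℕ} (π : Equiv.Perm (Fin (n + 1))) : ∃ v σ, π = consPerm v σ :=
  ⟨_, _, ((consPermEquiv n).apply_symm_apply π).symm⟩

theorem length_lehmerCode {n : ℕ} (π : Equiv.Perm (Fin n)) : (lehmerCode n π).length = n := by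
  induction n with
  | zero => rfl
  | succ n ih =>
    obtain ⟨v, σ, rfl⟩ := exists_consPerm π
    rw [lehmerCode_consPerm, List.length_cons, ih]

theorem head?_lehmerCode {n : ℕ} (π : Equiv.Perm (Fin (n + 1))) :
    (lehmerCode (n + 1) π).head? = some (π 0 : ℕ) := by
  obtain ⟨v, σ, rfl⟩ := exists_consPerm π
  rw [lehmerCode_consPerm, List.head?_cons, consPerm_zero]

/-! ### Counting occurrences through the code -/

/-- The number of pairs of positions `i < j` in relation `R` with values `w ≤ π i < π j`. -/
def ascCount (R : ℕ → ℕ → Bool) {n : ℕ} (π : Equiv.Perm (Fin n)) (w : ℕ) : ℕ :=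
  ∑ i : Fin n, ∑ j : Fin n,
    if (i : ℕ) < j ∧ w ≤ π i ∧ (π i : ℕ) < π j ∧ R i j then 1 else 0

/-- The number of occurrences of 1-2-3 in which the positions are in relation `Q`. -/
def occCount (Q : ℕ → ℕ → ℕ → Bool) {n : ℕ} (π : Equiv.Perm (Fin n)) : ℕ :=
  ∑ i : Fin n, ∑ j : Fin n, ∑ k : Fin n,
    if (i : ℕ) < j ∧ (j : ℕ) < k ∧ (π i : ℕ) < π j ∧ (π j : ℕ) < π k ∧ Q i j k then 1 else 0

theorem val_succAbove {n : ℕ} (v : Fin (n + 1)) (x : Fin n) :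
    (v.succAbove x : ℕ) = if (x : ℕ) < v then (x : ℕ) else x + 1 := by
  simp only [Fin.succAbove, Fin.lt_def, Fin.val_castSucc]
  split_ifs <;> rfl

/-- Old positions move by one, hence the shifted relation. A threshold above `v` drops by one
because the old values that are at least `v` were raised. -/
theorem ascCount_consPerm (R : ℕ → ℕ → Bool) {n : ℕ} (v : Fin (n + 1)) (π : Equiv.Perm (Fin n))
    (w : ℕ) :
    ascCount R (consPerm v π) w =
      (if w ≤ v then ∑ j : Fin n, if (v : ℕ) ≤ π j ∧ R 0 (j + 1) then 1 else 0 else 0) +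
        ascCount (fun i j => R (i + 1) (j + 1)) π (if w ≤ v then w else w - 1) := by
  simp only [ascCount, Fin.sum_univ_succ, consPerm_zero, consPerm_succ, Fin.val_zero, Fin.val_succ]
  simp only [lt_irrefl, false_and, if_false, Nat.not_lt_zero, zero_add,
    Nat.zero_lt_succ, true_and, Nat.add_lt_add_iff_right]
  congr 1
  · split_ifs with hw
    · refine Finset.sum_congr rfl fun j _ => if_congr ?_ rfl rfl
      rw [val_succAbove]
      cases R 0 (j + 1) <;> simp [hw]
      split_ifs <;> omega
    · simp [hw]
  · refine Finset.sum_congr rfl fun i _ => Finset.sum_congr rfl fun j _ => if_congr ?_ rfl rfl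
    rw [val_succAbove, val_succAbove]
    cases R (i + 1) (j + 1) <;> simp
    split_ifs <;> omega

theorem sum_le_apply {n : ℕ} (π : Equiv.Perm (Fin n)) (v : ℕ) :
    (∑ j : Fin n, if v ≤ (π j : ℕ) then 1 else 0) = n - v := by
  rw [Equiv.sum_comp π fun x : Fin n => if v ≤ (x : ℕ) then 1 else 0,
    Fin.sum_univ_eq_sum_range (fun x => if v ≤ x then 1 else 0), ← Finset.sum_filter,
    Finset.sum_const, smul_eq_mul, mul_one]
  have : (Finset.range n).filter (fun x => v ≤ x) = Finset.Ico v n := by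
    ext x
    simp only [Finset.mem_filter, Finset.mem_range, Finset.mem_Ico]
    omega
  rw [this, Nat.card_Ico]

theorem codeAsc_lehmerCode {n : ℕ} (π : Equiv.Perm (Fin n)) (w : ℕ) :
    codeAsc (lehmerCode n π) w = ascCount (fun _ _ => true) π w := by
  induction n generalizing w with
  | zero => simp [lehmerCode, codeAsc, ascCount]
  | succ n ih =>
    obtain ⟨v, σ, rfl⟩ := exists_consPerm π
    rw [lehmerCode_consPerm, ascCount_consPerm, codeAsc, length_lehmerCode, ih, ih]
    simp only [and_true, sum_le_apply]
    split_ifs <;> simp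

theorem codeAdj_lehmerCode {n : ℕ} (π : Equiv.Perm (Fin n)) (w : ℕ) :
    codeAdj (lehmerCode n π) w = ascCount (fun i j => j = i + 1) π w := by
  induction n generalizing w with
  | zero => simp [lehmerCode, codeAdj, ascCount]
  | succ n ih =>
    obtain ⟨v, σ, rfl⟩ := exists_consPerm π
    rw [lehmerCode_consPerm, ascCount_consPerm, codeAdj, ih, ih]
    have hhead : (if ∃ u ∈ (lehmerCode n σ).head?, (v : ℕ) ≤ u then 1 else 0) =
        ∑ j : Fin n, if (v : ℕ) ≤ σ j ∧ decide ((j : ℕ) + 1 = 0 + 1) = true then 1 else 0 := by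
      cases n with
      | zero => simp [lehmerCode]
      | succ n =>
        rw [head?_lehmerCode, Fin.sum_univ_succ]
        simp
    rw [hhead]
    simp only [Nat.add_right_cancel_iff]
    split_ifs <;> simp

theorem codeInit_lehmerCode {n : ℕ} (π : Equiv.Perm (Fin n)) (w : ℕ) :
    codeInit (lehmerCode n π) w = ascCount (fun i _ => i = 0) π w := by
  cases n with
  | zero => simp [lehmerCode, codeInit, ascCount]
  | succ n =>
    obtain ⟨v, σ, rfl⟩ := exists_consPerm π
    rw [lehmerCode_consPerm, ascCount_consPerm, codeInit, length_lehmerCode]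
    simp only [decide_true, and_true, sum_le_apply]
    -- The shifted relation reads `i + 1 = 0`, so the tail contributes nothing.
    simp [ascCount]

theorem occCount_consPerm (Q : ℕ → ℕ → ℕ → Bool) {n : ℕ} (v : Fin (n + 1))
    (π : Equiv.Perm (Fin n)) :
    occCount Q (consPerm v π) =
      ascCount (fun j k => Q 0 (j + 1) (k + 1)) π v +
        occCount (fun i j k => Q (i + 1) (j + 1) (k + 1)) π := by
  simp only [occCount, ascCount, Fin.sum_univ_succ, consPerm_zero, consPerm_succ, Fin.val_zero,
    Fin.val_succ]
  simp only [lt_irrefl, false_and, and_false, if_false, Nat.not_lt_zero,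
    Finset.sum_const_zero, zero_add, Nat.zero_lt_succ, true_and, Nat.add_lt_add_iff_right]
  congr 1
  · refine Finset.sum_congr rfl fun i _ => Finset.sum_congr rfl fun j _ => if_congr ?_ rfl rfl
    rw [val_succAbove, val_succAbove]
    cases Q 0 (i + 1) (j + 1) <;> simp
    split_ifs <;> omega
  · refine Finset.sum_congr rfl fun i _ => Finset.sum_congr rfl fun j _ =>
      Finset.sum_congr rfl fun k _ => if_congr ?_ rfl rfl
    simp only [← Fin.lt_def, Fin.succAbove_lt_succAbove_iff]

theorem codeOcc_lehmerCode {n : ℕ} (π : Equiv.Perm (Fin n)) :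
    codeOcc (lehmerCode n π) = occCount (fun _ _ _ => true) π := by
  induction n with
  | zero => simp [lehmerCode, codeOcc, occCount]
  | succ n ih =>
    obtain ⟨v, σ, rfl⟩ := exists_consPerm π
    rw [lehmerCode_consPerm, occCount_consPerm, codeOcc, codeAsc_lehmerCode, ih]

theorem codeOcc1d23_lehmerCode {n : ℕ} (π : Equiv.Perm (Fin n)) :
    codeOcc1d23 (lehmerCode n π) = occCount (fun _ j k => k = j + 1) π := by
  induction n with
  | zero => simp [lehmerCode, codeOcc1d23, occCount]
  | succ n ih =>
    obtain ⟨v, σ, rfl⟩ := exists_consPerm π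
    rw [lehmerCode_consPerm, occCount_consPerm, codeOcc1d23, codeAdj_lehmerCode, ih]
    simp only [Nat.add_right_cancel_iff]

theorem codeOcc12d3_lehmerCode {n : ℕ} (π : Equiv.Perm (Fin n)) :
    codeOcc12d3 (lehmerCode n π) = occCount (fun i j _ => j = i + 1) π := by
  induction n with
  | zero => simp [lehmerCode, codeOcc12d3, occCount]
  | succ n ih =>
    obtain ⟨v, σ, rfl⟩ := exists_consPerm π
    rw [lehmerCode_consPerm, occCount_consPerm, codeOcc12d3, codeInit_lehmerCode, ih]
    simp only [Nat.add_right_cancel_iff]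

theorem card_filter_eq_occCount {n : ℕ} (π : Equiv.Perm (Fin n)) (Q : ℕ → ℕ → ℕ → Bool) :
    ((occurrences1d2d3 π).filter fun t => Q t.1 t.2.1 t.2.2).card = occCount Q π := by
  rw [occurrences1d2d3, Finset.filter_filter, Finset.card_filter, Fintype.sum_prod_type]
  simp only [Fintype.sum_prod_type, occCount, Fin.lt_def, and_assoc]

theorem isGood_lehmerCode_iff {n : ℕ} (π : Equiv.Perm (Fin n)) :
    IsGood (lehmerCode n π) ↔
      (occurrences1d2d3 π).card = 1 ∧ (occurrences1d23 π).card = 0 ∧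
        (occurrences12d3 π).card = 0 := by
  have h1 := card_filter_eq_occCount π fun _ _ _ => true
  have h2 := card_filter_eq_occCount π fun _ j k => k = j + 1
  have h3 := card_filter_eq_occCount π fun i j _ => j = i + 1
  simp only [Finset.filter_true, decide_eq_true_eq] at h1 h2 h3
  rw [IsGood, codeOcc_lehmerCode, codeOcc1d23_lehmerCode, codeOcc12d3_lehmerCode, ← h1, ← h2, ← h3,
    occurrences1d23, occurrences12d3]

/-- Splitting off the first value of a permutation trades one code entry for one more extension
step; `r = 0` gives the count of good permutations. -/
theorem sum_goodExt_lehmerCode (n r : ℕ) :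
    ∑ π : Equiv.Perm (Fin n), goodExt r (lehmerCode n π) = goodExt (n + r) [] := by
  induction n generalizing r with
  | zero => simp [lehmerCode]
  | succ n ih =>
    rw [add_right_comm, add_assoc, ← ih, ← Equiv.sum_comp (consPermEquiv n),
      Fintype.sum_prod_type_right]
    refine Finset.sum_congr rfl fun π _ => ?_
    rw [goodExt, length_lehmerCode, ← Fin.sum_univ_eq_sum_range]
    refine Finset.sum_congr rfl fun v _ => ?_
    rw [← lehmerCode_consPerm]
    rfl

theorem countPerms_eq_goodExt (n : ℕ) : countPerms n = goodExt n [] := by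
  have h := sum_goodExt_lehmerCode n 0
  rw [add_zero] at h
  rw [← h, countPerms, Finset.card_filter]
  exact Finset.sum_congr rfl fun π _ => if_congr (isGood_lehmerCode_iff π).symm rfl rfl

/-! ### Powers of the Catalan generating function -/

open PowerSeries in
theorem coeff_catalanSeries_pow_add_two (k n : ℕ) :
    coeff (n + 1) (catalanSeries ^ (k + 1)) =
      coeff (n + 1) (catalanSeries ^ k) + coeff n (catalanSeries ^ (k + 2)) := by
  have h : catalanSeries ^ (k + 1) = catalanSeries ^ k + X * catalanSeries ^ (k + 2) := by
    calc catalanSeries ^ (k + 1) = catalanSeries ^ k * (catalanSeries ^ 2 * X + 1) := by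
          rw [catalanSeries_sq_mul_X_add_one, pow_succ]
      _ = _ := by ring
  rw [h, map_add, coeff_succ_X_mul]

-- The preceding recurrence expresses the power `k + 2` through the two lower ones, hence the
-- two-step induction. The case `n = k = 0` is excluded because the coefficient is 1 while `0 / 0 =
-- 0`.
open PowerSeries in
theorem coeff_catalanSeries_pow (k n : ℕ) (h : 0 < n + k) :
    ((coeff n (catalanSeries ^ k) : ℕ) : ℚ) = k / (n + k) * Nat.choose (2 * n + k - 1) n := by
  induction k using Nat.twoStepInduction generalizing n with
  | zero => simp [coeff_one, (show n ≠ 0 by omega)]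
  | one =>
    rw [pow_one, catalanSeries_coeff, catalan_eq_centralBinom_div,
      Nat.cast_div (Nat.succ_dvd_centralBinom n) (by positivity), Nat.centralBinom,
      Nat.add_sub_cancel]
    push_cast
    ring
  | more k ih0 ih1 =>
    have hrec := coeff_catalanSeries_pow_add_two k n
    have h0 := ih0 (n + 1) (by omega)
    have h1 := ih1 (n + 1) (by omega)
    rw [hrec] at h1
    rw [show 2 * (n + 1) + (k + 1) - 1 = (2 * n + k + 1) + 1 by omega, Nat.choose_succ_succ'] at h1
    rw [show 2 * (n + 1) + k - 1 = 2 * n + k + 1 by omega] at h0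
    rw [show 2 * n + (k + 2) - 1 = 2 * n + k + 1 by omega]
    have hc := Nat.choose_succ_right_eq (2 * n + k + 1) n
    rw [show 2 * n + k + 1 - n = n + k + 1 by omega] at hc
    have hc' := congrArg (Nat.cast (R := ℚ)) hc
    push_cast at h0 h1 hc' ⊢
    rw [h0] at h1
    have e1 : (n : ℚ) + 1 + k ≠ 0 := by positivity
    have e2 : (n : ℚ) + 1 + (k + 1) ≠ 0 := by positivity
    have e3 : (n : ℚ) + (k + 2) ≠ 0 := by positivity
    rw [← eq_sub_iff_add_eq'] at h1
    rw [h1]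
    field_simp
    linear_combination (n + k + 2 : ℚ) * hc'

theorem theorem11 :
    (PowerSeries.mk countPerms : PowerSeries ℕ) =
        PowerSeries.X ^ 5 * PowerSeries.catalanSeries ^ 8 ∧
      (∀ n : ℕ, n < 5 → countPerms n = 0) ∧
      ∀ n : ℕ, 5 ≤ n →
        (countPerms n : ℚ) = 8 / ((n : ℚ) + 3) * (Nat.choose (2 * n - 3) (n + 2) : ℚ) := by
  have hcount (n : ℕ) : countPerms n =
      PowerSeries.coeff n (PowerSeries.X ^ 5 * PowerSeries.catalanSeries ^ 8) := by
    rw [countPerms_eq_goodExt, goodExt_nil]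
  refine ⟨?_, fun n hn => ?_, fun n hn => ?_⟩
  · ext n
    rw [PowerSeries.coeff_mk, hcount]
  · rw [hcount, PowerSeries.coeff_X_pow_mul', if_neg (by omega)]
  · obtain ⟨m, rfl⟩ := Nat.exists_eq_add_of_le' hn
    rw [hcount, PowerSeries.coeff_X_pow_mul, coeff_catalanSeries_pow 8 m (by omega),
      show 2 * (m + 5) - 3 = 2 * m + 7 by omega, show 2 * m + 8 - 1 = 2 * m + 7 by omega,
      Nat.choose_symm_of_eq_add (show 2 * m + 7 = (m + 5 + 2) + m by omega)]
    push_cast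
    ring
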